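/- **Setting.** Fix integers $d, M, T \ge 1$ and let the arm space be $\mathcal X=[0,1]^d$ with the distance $\|x-y\|_\infty$. A federated $\mathcal X$-armed bandit instance with $M$ clients consists of, for every client $m\in[M]$ and arm $x\in\mathcal X$, a reward distribution $\nu_m(x)$ on $[0,1]$ (measurable in $x$). The local objective of client $m$ is the mean reward $f_m(x)=\int r\,\nu_m(x)(\mathrm dr)$ and the global objective is $f=\frac1M\sum_{m=1}^M f_m$. In each round $t=1,\dots,T$ every client $m$ pulls an arm $x_{m,t}$ and receives a reward $r_{m,t}\sim\nu_m(x_{m,t})$; given the arms pulled in round $t$, the rewards of that round are independent of each other and of the past. Policies $\pi_1,\dots,\pi_M$ choose each $x_{m,t}$ as a measurable function of the arms and rewards of all $M$ clients in rounds $1,\dots,t-1$ (arbitrary communication between rounds is allowed) and of a random seed with an arbitrary law, which is independent of the instance (arbitrary private or shared randomization). The cumulative regret is $$R(T)=\sum_{t=1}^T\sum_{m=1}^M\Bigl(\sup_{x\in\mathcal X} f(x)-f(x_{m,t})\Bigr).$$ **Theorem.** There is an absolute constant $c>0$ such that for all $d,M,T\ge1$ and all policies $\pi_1,\dots,\pi_M$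 of the $M$ clients on $[0,1]^d$, there is a federated $\mathcal X$-armed bandit instance with identical local objectives, $f_m=f$ for all $m\in[M]$, and with $f$ $1$-Lipschitz with respect to $\|\cdot\|_\infty$, for which $$\mathbb E_{\pi_1,\dots,\pi_M}\bigl[R(T)\bigr]\;\ge\; c\,M^{\frac{d+1}{d+2}}\,T^{\frac{d+1}{d+2}}.$$ -/

import Mathlib

open MeasureTheory ProbabilityTheory

namespace FedBandit

noncomputable section

/-- The `d`-dimensional arm space `[0,1]^d`. As a finite product of copies of `[0,1]` it carries the
sup-norm distance and the Borel (product) sigma-algebra. -/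
abbrev Cube (d : ℕ) : Type := Fin d → unitInterval

/-- A federated bandit instance with arm space `X` and `M` clients. When client `m` pulls the arm
`x` it receives a random reward in `[0,1]` with law `reward m x`. -/
structure Instance (X : Type) [MeasurableSpace X] (M : ℕ) where
  reward : Fin M → Kernel X ℝ
  isMarkov : ∀ m, IsMarkovKernel (reward m)
  bounded : ∀ m x, ∀ᵐ r ∂(reward m x), r ∈ Set.Icc (0 : ℝ) 1

/-- What happened in the rounds `0, …, t - 1`: for every round and every client, the arm that the
client pulled and the reward that it received. -/
abbrev History (X : Type) (M t : ℕ) : Type := Fin t → Fin M → X × ℝ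

/-- The policies of `M` clients. The seed in `S` is the source of all randomization, private or
shared (`S` may be a product with one factor for each client). In round `t`, client `m` pulls the
arm `act m t (s, h)`, where `s` is the seed and `h` is the history of *all* clients in the previous
rounds: communication between rounds is unrestricted, and there is none within a round. -/
structure Policy (S : Type*) [MeasurableSpace S] (X : Type) [MeasurableSpace X] (M : ℕ) where
  act : Fin M → (t : ℕ) → S × History X M t → X
  measurable_act : ∀ m t, Measurable (act m t)

section Instances

variable {X : Type} [MeasurableSpace X] {M : ℕ}

/-- The local objective `f_m` of client `m`: the mean reward of each arm. -/
def Instance.localObjective (I : Instance X M) (m : Fin M) (x : X) : ℝ :=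
  ∫ r, r ∂(I.reward m x)

/-- The global objective `f`: the average of the local objectives. -/
def Instance.globalObjective (I : Instance X M) (x : X) : ℝ :=
  (∑ m, I.localObjective m x) / M

/-- The cumulative regret of all clients along a history, measured by the global objective. -/
def Instance.regret (I : Instance X M) {T : ℕ} (h : History X M T) : ℝ :=
  ∑ t, ∑ m, ((⨆ x, I.globalObjective x) - I.globalObjective (h t m).1)

theorem Instance.measurable_pi_reward (I : Instance X M) :
    Measurable (fun x : Fin M → X => Measure.pi (fun m => I.reward m (x m))) := by
  have := I.isMarkov
  refine Measurable.measure_of_isPiSystem_of_isProbabilityMeasure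
    generateFrom_pi.symm isPiSystem_pi ?_
  rintro _ ⟨s, hs, rfl⟩
  simp only [Measure.pi_pi]
  exact Finset.measurable_prod _ fun m _ =>
    ((I.reward m).measurable_coe (hs m (Set.mem_univ m))).comp (measurable_pi_apply m)

/-- Given the arms pulled in a round, the rewards of the clients are independent, and the reward of
client `m` has law `I.reward m (x m)`. -/
def Instance.roundRewards (I : Instance X M) : Kernel (Fin M → X) (Fin M → ℝ) where
  toFun x := Measure.pi (fun m => I.reward m (x m))
  measurable' := I.measurable_pi_reward

end Instances

section Interaction

variable {S : Type*} [MeasurableSpace S] {X : Type} [MeasurableSpace X] {M : ℕ}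

/-- The arms pulled by all clients in round `t`. -/
def Policy.arms (π : Policy S X M) (t : ℕ) (p : S × History X M t) : Fin M → X :=
  fun m => π.act m t p

theorem Policy.measurable_arms (π : Policy S X M) (t : ℕ) : Measurable (π.arms t) :=
  measurable_pi_lambda _ fun m => π.measurable_act m t

/-- Append round `t`, with the given rewards, to the history. -/
def Policy.extend (π : Policy S X M) (t : ℕ)
    (q : S × (History X M t × (Fin M → ℝ))) : History X M (t + 1) :=
  Fin.snoc (α := fun _ => Fin M → X × ℝ) q.2.1 fun m => (π.act m t (q.1, q.2.1), q.2.2 m)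

theorem Policy.measurable_extend (π : Policy S X M) (t : ℕ) : Measurable (π.extend t) := by
  refine measurable_pi_lambda _ fun i => ?_
  refine Fin.lastCases ?_ (fun j => ?_) i
  · simp only [Policy.extend, Fin.snoc_last]
    refine measurable_pi_lambda _ fun m => ?_
    have := π.measurable_act m t
    fun_prop
  · simp only [Policy.extend, Fin.snoc_castSucc]
    fun_prop

/-- The conditional law, given the seed, of the history of the first `t` rounds when the clients
follow the policies `π` on the instance `I`. -/
def historyKernel (π : Policy S X M) (I : Instance X M) : (t : ℕ) → Kernel S (History X M t)
  | 0 => Kernel.const S (Measure.dirac Fin.elim0)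
  | t + 1 =>
      (Kernel.id ×ₖ
        (historyKernel π I t ⊗ₖ I.roundRewards.comap (π.arms t) (π.measurable_arms t))).map
          (π.extend t)

/-- The law of the history of the first `T` rounds, for a seed with law `P`. -/
def historyLaw (P : Measure S) (π : Policy S X M) (I : Instance X M) (T : ℕ) :
    Measure (History X M T) :=
  P.bind (historyKernel π I T)

/-- The expected cumulative regret over `T` rounds. -/
def expectedRegret (P : Measure S) (π : Policy S X M) (I : Instance X M) (T : ℕ) : ℝ :=
  ∫ h, I.regret h ∂(historyLaw P π I T)

end Interaction

end

end FedBandit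

namespace FedBandit

noncomputable section

/-! ### Integration along the history of an interaction. -/

section HistoryLaw

variable {S : Type*} [MeasurableSpace S] {X : Type} [MeasurableSpace X] {M : ℕ}

/-! Since communication is unrestricted, the clients act together as one learner with `T * M` pulls,
and a needle-in-a-haystack argument applies. The cube contains `K ^ d` pairwise disjoint balls of
radius `ε = 1 / (4 * K)`. Rewards are Bernoulli with mean `1 / 2`, raised by a cone of height `ε` on
one hidden ball, so every pull outside that ball costs `ε`.

When all coins are fair, some ball receives at most `T * M / K ^ d` pulls in expectation
(`exists_integral_pullCount_le`). Hiding the cone there changes the law of the history by a density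
`L` (`historyLaw_coinInstance`), and the relative entropy of the fair law with respect to the new
one is at most `4 * ε ^ 2` times the expected number of pulls of the ball under fair coins
(`integral_log_historyLikelihood_ge`). If `ε ^ 2 * T * M` is a small multiple of `K ^ d`, this
entropy is small, so the pull count of the ball grows by only a fraction of `T * M`
(`integral_pullCount_coinInstance_le`). At least a quarter of the pulls then miss the ball in
expectation, and the regret is at least `ε * T * M / 4`. Taking `K` of order `(T * M) ^ (1 / (d +
2))` balances the two requirements. -/

instance Instance.isMarkovKernel_reward (I : Instance X M) (m : Fin M) :
    IsMarkovKernel (I.reward m) := I.isMarkov m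

instance Instance.isMarkovKernel_roundRewards (I : Instance X M) :
    IsMarkovKernel I.roundRewards :=
  ⟨fun x => by
    change IsProbabilityMeasure (Measure.pi fun m => I.reward m (x m))
    infer_instance⟩

instance isMarkovKernel_historyKernel (π : Policy S X M) (I : Instance X M) (t : ℕ) :
    IsMarkovKernel (historyKernel π I t) := by
  induction t with
  | zero => rw [historyKernel]; infer_instance
  | succ t ih => rw [historyKernel]; exact Kernel.IsMarkovKernel.map _ (π.measurable_extend t)

instance isProbabilityMeasure_historyLaw (P : Measure S) [IsProbabilityMeasure P]
    (π : Policy S X M) (I : Instance X M) (T : ℕ) :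
    IsProbabilityMeasure (historyLaw P π I T) := by
  unfold historyLaw; infer_instance

theorem historyKernel_succ_apply (π : Policy S X M) (I : Instance X M) (t : ℕ) (s : S) :
    historyKernel π I (t + 1) s =
      ((historyKernel π I t s) ⊗ₘ
        (I.roundRewards.comap (π.arms t) (π.measurable_arms t)).sectR s).map
          (fun q => π.extend t (s, q)) := by
  rw [historyKernel, Kernel.map_apply _ (π.measurable_extend t), Kernel.prod_apply,
    Kernel.id_apply, Measure.dirac_prod, Kernel.compProd_apply_eq_compProd_sectR,
    Measure.map_map (π.measurable_extend t) measurable_prodMk_left]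
  rfl

theorem lintegral_historyKernel_succ (π : Policy S X M) (I : Instance X M) (t : ℕ) (s : S)
    {g : History X M (t + 1) → ENNReal} (hg : Measurable g) :
    ∫⁻ h, g h ∂(historyKernel π I (t + 1) s) =
      ∫⁻ h, ∫⁻ r, g (π.extend t (s, (h, r))) ∂(Measure.pi fun m => I.reward m (π.act m t (s, h)))
        ∂(historyKernel π I t s) := by
  have he : Measurable fun q => π.extend t (s, q) :=
    (π.measurable_extend t).comp measurable_prodMk_left
  rw [historyKernel_succ_apply, lintegral_map hg he]
  exact Measure.lintegral_compProd (hg.comp he)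

theorem integral_historyKernel_succ (π : Policy S X M) (I : Instance X M) (t : ℕ) (s : S)
    {g : History X M (t + 1) → ℝ} (hg : Measurable g) {B : ℝ} (hB : ∀ h, |g h| ≤ B) :
    ∫ h, g h ∂(historyKernel π I (t + 1) s) =
      ∫ h, ∫ r, g (π.extend t (s, (h, r))) ∂(Measure.pi fun m => I.reward m (π.act m t (s, h)))
        ∂(historyKernel π I t s) := by
  have he : Measurable fun q => π.extend t (s, q) :=
    (π.measurable_extend t).comp measurable_prodMk_left
  rw [historyKernel_succ_apply, integral_map he.aemeasurable hg.aestronglyMeasurable,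
    Measure.integral_compProd]
  · rfl
  · exact Integrable.of_bound (hg.comp he).aestronglyMeasurable B (.of_forall fun _ => hB _)

theorem integral_historyLaw (P : Measure S) [IsProbabilityMeasure P] (π : Policy S X M)
    (I : Instance X M) (T : ℕ) {g : History X M T → ℝ} (hg : Measurable g) {B : ℝ}
    (hB : ∀ h, |g h| ≤ B) :
    ∫ h, g h ∂(historyLaw P π I T) = ∫ s, ∫ h, g h ∂(historyKernel π I T s) ∂P := by
  rw [historyLaw, ← Measure.snd_compProd, Measure.snd,
    integral_map measurable_snd.aemeasurable hg.aestronglyMeasurable, Measure.integral_compProd]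
  exact Integrable.of_bound (hg.comp measurable_snd).aestronglyMeasurable B
    (.of_forall fun _ => hB _)

/-- The sum of `φ (arm, reward)` over all pulls of a history. -/
def sumPulls (φ : X × ℝ → ℝ) {t : ℕ} (h : History X M t) : ℝ := ∑ i, ∑ m, φ (h i m)

theorem measurable_sumPulls {φ : X × ℝ → ℝ} (hφ : Measurable φ) (t : ℕ) :
    Measurable (sumPulls φ : History X M t → ℝ) := by
  unfold sumPulls; fun_prop

theorem abs_sumPulls_le {X : Type} {φ : X × ℝ → ℝ} {B : ℝ} (hB : ∀ p, |φ p| ≤ B) {t : ℕ}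
    (h : History X M t) : |sumPulls φ h| ≤ t * (M * B) := by
  calc |sumPulls φ h| ≤ ∑ i, ∑ m, |φ (h i m)| :=
        (Finset.abs_sum_le_sum_abs _ _).trans
          (Finset.sum_le_sum fun _ _ => Finset.abs_sum_le_sum_abs _ _)
    _ ≤ ∑ _i : Fin t, ∑ _m : Fin M, B :=
        Finset.sum_le_sum fun _ _ => Finset.sum_le_sum fun _ _ => hB _
    _ = t * (M * B) := by simp

theorem integrable_sumPulls {φ : X × ℝ → ℝ} (hφ : Measurable φ) {B : ℝ} (hB : ∀ p, |φ p| ≤ B)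
    {t : ℕ} (μ : Measure (History X M t)) [IsFiniteMeasure μ] : Integrable (sumPulls φ) μ :=
  Integrable.of_bound (measurable_sumPulls hφ t).aestronglyMeasurable _
    (.of_forall fun h => abs_sumPulls_le hB h)

theorem sumPulls_extend (φ : X × ℝ → ℝ) (π : Policy S X M) (t : ℕ) (s : S) (h : History X M t)
    (r : Fin M → ℝ) :
    sumPulls φ (π.extend t (s, (h, r))) = sumPulls φ h + ∑ m, φ (π.act m t (s, h), r m) := by
  simp [sumPulls, Policy.extend, Fin.sum_univ_castSucc]

/-- This plays the role of the chain rule for relative entropy. The sums are a submartingale: given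
the past, each new pull adds a term of nonnegative mean, whatever arm the policy selects. -/
theorem integral_sumPulls_nonneg (P : Measure S) [IsProbabilityMeasure P] (π : Policy S X M)
    (I : Instance X M) (T : ℕ) {φ : X × ℝ → ℝ} (hφ : Measurable φ) {B : ℝ}
    (hB : ∀ p, |φ p| ≤ B) (h0 : ∀ m x, 0 ≤ ∫ r, φ (x, r) ∂(I.reward m x)) :
    0 ≤ ∫ h, sumPulls φ h ∂(historyLaw P π I T) := by
  rw [integral_historyLaw P π I T (measurable_sumPulls hφ T) (abs_sumPulls_le hB)]
  refine integral_nonneg fun s => ?_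
  change 0 ≤ ∫ h, sumPulls φ h ∂(historyKernel π I T s)
  induction T with
  | zero => simp [sumPulls]
  | succ t ih =>
    rw [integral_historyKernel_succ π I t s (measurable_sumPulls hφ _) (abs_sumPulls_le hB)]
    have hint : Integrable (fun w => ∫ r, sumPulls φ (π.extend t (s, (w, r)))
        ∂(Measure.pi fun m => I.reward m (π.act m t (s, w)))) (historyKernel π I t s) := by
      refine Integrable.integral_compProd (κ := historyKernel π I t)
        (η := I.roundRewards.comap (π.arms t) (π.measurable_arms t))
        (f := fun q => sumPulls φ (π.extend t (s, q))) ?_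
      exact Integrable.of_bound ((measurable_sumPulls hφ _).comp
        ((π.measurable_extend t).comp measurable_prodMk_left)).aestronglyMeasurable _
        (.of_forall fun _ => abs_sumPulls_le hB _)
    -- It suffices that, for each fixed past `w`, averaging over the new rewards does not decrease
    -- the sum.
    refine ih.trans (integral_mono (integrable_sumPulls hφ hB _) hint fun w => ?_)
    have hφm (m : Fin M) : Measurable fun r => φ (π.act m t (s, w), r) :=
      hφ.comp measurable_prodMk_left
    have hi (m : Fin M) : Integrable (fun r : Fin M → ℝ => φ (π.act m t (s, w), r m))
        (Measure.pi fun m => I.reward m (π.act m t (s, w))) :=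
      Integrable.of_bound ((hφm m).comp (measurable_pi_apply m)).aestronglyMeasurable B
        (.of_forall fun _ => hB _)
    simp only [sumPulls_extend]
    rw [integral_add (integrable_const _) (integrable_finsetSum _ fun m _ => hi m),
      integral_finsetSum _ fun m _ => hi m]
    simp only [integral_const, probReal_univ, one_smul, le_add_iff_nonneg_right]
    refine Finset.sum_nonneg fun m _ => ?_
    rw [integral_comp_eval (μ := fun m => I.reward m (π.act m t (s, w)))
      (f := fun r => φ (π.act m t (s, w), r)) (hφm m).aestronglyMeasurable]
    exact h0 m _

end HistoryLaw

/-! ### Bernoulli rewards and their likelihood ratios. -/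

section CoinFlips

open scoped ENNReal

/-- The law of a fair coin flip with values `0` and `1`. -/
def fairCoin : Measure ℝ := (2⁻¹ : ℝ≥0∞) • Measure.dirac 0 + (2⁻¹ : ℝ≥0∞) • Measure.dirac 1

instance : IsProbabilityMeasure fairCoin :=
  ⟨by simp [fairCoin, ENNReal.inv_two_add_inv_two]⟩

theorem lintegral_fairCoin (g : ℝ → ℝ≥0∞) : ∫⁻ r, g r ∂fairCoin = 2⁻¹ * (g 0 + g 1) := by
  simp [fairCoin, mul_add]

theorem integral_fairCoin (g : ℝ → ℝ) : ∫ r, g r ∂fairCoin = (g 0 + g 1) / 2 := by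
  rw [fairCoin, integral_add_measure
    ((integrable_dirac (by simp)).smul_measure (by simp))
    ((integrable_dirac (by simp)).smul_measure (by simp))]
  simp; ring

/-- The sign attached to a reward: `1` for the reward `1`, and `-1` for the reward `0`. -/
def coinSign (r : ℝ) : ℝ := if 1 / 2 < r then 1 else -1

@[fun_prop]
theorem measurable_coinSign : Measurable coinSign :=
  Measurable.ite (measurableSet_lt measurable_const measurable_id) measurable_const
    measurable_const

/-- Valid for every real `r`, not only for the rewards `0` and `1`; hence all bounds on likelihoods
below hold pointwise rather than almost everywhere. -/
theorem abs_coinSign (r : ℝ) : |coinSign r| = 1 := by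
  unfold coinSign; split_ifs <;> simp

theorem coinSign_zero : coinSign 0 = -1 := by norm_num [coinSign]

theorem coinSign_one : coinSign 1 = 1 := by norm_num [coinSign]

variable {X : Type} [MeasurableSpace X]

/-- The likelihood ratio of a reward with mean `1 / 2 + b x` against a fair coin flip. -/
def likelihood (b : X → ℝ) (p : X × ℝ) : ℝ := 1 + 2 * b p.1 * coinSign p.2

theorem measurable_likelihood {b : X → ℝ} (hb : Measurable b) : Measurable (likelihood b) := by
  unfold likelihood; fun_prop

theorem abs_likelihood_sub_one {X : Type} {b : X → ℝ} (p : X × ℝ) :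
    |likelihood b p - 1| = 2 * |b p.1| := by
  simp [likelihood, abs_mul, abs_coinSign]

/-- The restriction `|b x| ≤ 1 / 4` keeps likelihoods away from `0`, so that their logarithms are
bounded and integrable. -/
theorem half_le_likelihood {X : Type} {b : X → ℝ} (h : ∀ x, |b x| ≤ 1 / 4) (p : X × ℝ) :
    1 / 2 ≤ likelihood b p := by
  have h1 := abs_likelihood_sub_one (b := b) p
  have h2 := neg_abs_le (likelihood b p - 1)
  linarith [h p.1]

theorem likelihood_le {X : Type} {b : X → ℝ} (h : ∀ x, |b x| ≤ 1 / 4) (p : X × ℝ) :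
    likelihood b p ≤ 3 / 2 := by
  have h1 := abs_likelihood_sub_one (b := b) p
  have h2 := le_abs_self (likelihood b p - 1)
  linarith [h p.1]

theorem likelihood_pos {X : Type} {b : X → ℝ} (h : ∀ x, |b x| ≤ 1 / 4) (p : X × ℝ) : 0 < likelihood b p :=
  lt_of_lt_of_le (by norm_num) (half_le_likelihood h p)

/-- The kernel of Bernoulli rewards with mean `1 / 2 + b x`. -/
def coinKernel (b : X → ℝ) : Kernel X ℝ :=
  Kernel.withDensity (Kernel.const X fairCoin) fun x r => ENNReal.ofReal (likelihood b (x, r))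

theorem coinKernel_apply {b : X → ℝ} (hb : Measurable b) (x : X) :
    coinKernel b x = fairCoin.withDensity fun r => ENNReal.ofReal (likelihood b (x, r)) := by
  rw [coinKernel, Kernel.withDensity_apply _ (measurable_likelihood hb).ennreal_ofReal]
  simp

theorem isMarkovKernel_coinKernel {b : X → ℝ} (hb : Measurable b) (h : ∀ x, |b x| ≤ 1 / 4) :
    IsMarkovKernel (coinKernel b) := by
  refine ⟨fun x => ⟨?_⟩⟩
  rw [coinKernel_apply hb, withDensity_apply _ MeasurableSet.univ, Measure.restrict_univ,
    lintegral_fairCoin, ← ENNReal.ofReal_add (likelihood_pos h _).le (likelihood_pos h _).le]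
  simp only [likelihood, coinSign_zero, coinSign_one]
  ring_nf
  simp [ENNReal.inv_mul_cancel]

/-- The instance in which all clients receive Bernoulli rewards with mean `1 / 2 + b x`. -/
def coinInstance (M : ℕ) (b : X → ℝ) (hb : Measurable b) (h : ∀ x, |b x| ≤ 1 / 4) :
    Instance X M where
  reward _ := coinKernel b
  isMarkov _ := isMarkovKernel_coinKernel hb h
  bounded _ x := by
    rw [coinKernel_apply hb]
    refine (withDensity_absolutelyContinuous _ _).ae_le ?_
    change ∀ᵐ r ∂fairCoin, r ∈ Set.Icc (0 : ℝ) 1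
    simp [ae_iff, fairCoin]

theorem reward_coinInstance (M : ℕ) {b : X → ℝ} (hb : Measurable b) (h : ∀ x, |b x| ≤ 1 / 4)
    (m : Fin M) : (coinInstance M b hb h).reward m = coinKernel b := rfl

theorem integral_coinKernel {b : X → ℝ} (hb : Measurable b) (h : ∀ x, |b x| ≤ 1 / 4) (x : X)
    (g : ℝ → ℝ) :
    ∫ r, g r ∂(coinKernel b x) = ((1 - 2 * b x) * g 0 + (1 + 2 * b x) * g 1) / 2 := by
  rw [coinKernel_apply hb, integral_withDensity_eq_integral_toReal_smul _ (by simp),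
    integral_fairCoin]
  · simp only [ENNReal.toReal_ofReal (likelihood_pos h _).le, smul_eq_mul]
    simp only [likelihood, coinSign_zero, coinSign_one]
    ring
  · exact ((measurable_likelihood hb).comp measurable_prodMk_left).ennreal_ofReal

theorem localObjective_coinInstance (M : ℕ) {b : X → ℝ} (hb : Measurable b)
    (h : ∀ x, |b x| ≤ 1 / 4) (m : Fin M) (x : X) :
    (coinInstance M b hb h).localObjective m x = 1 / 2 + b x := by
  change ∫ r, r ∂(coinKernel b x) = _
  rw [integral_coinKernel hb h]
  ring

theorem globalObjective_coinInstance {M : ℕ} (hM : 1 ≤ M) {b : X → ℝ} (hb : Measurable b)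
    (h : ∀ x, |b x| ≤ 1 / 4) (x : X) :
    (coinInstance M b hb h).globalObjective x = 1 / 2 + b x := by
  have : (M : ℝ) ≠ 0 := by positivity
  simp only [Instance.globalObjective, localObjective_coinInstance]
  simp only [Finset.sum_const, Finset.card_univ, Fintype.card_fin, nsmul_eq_mul]
  field_simp

theorem abs_zero_le_quarter {X : Type} (x : X) : |(0 : X → ℝ) x| ≤ 1 / 4 := by simp

/-- The instance in which all rewards are fair coin flips. -/
abbrev fairInstance (X : Type) [MeasurableSpace X] (M : ℕ) : Instance X M :=
  coinInstance M 0 measurable_zero abs_zero_le_quarter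

theorem coinKernel_zero (x : X) : coinKernel (0 : X → ℝ) x = fairCoin := by
  rw [coinKernel_apply measurable_zero]
  simp [likelihood]

/-- Rewards within a round are independent, so their densities multiply; it is enough to compare
both measures on boxes. -/
theorem pi_coinKernel {M : ℕ} {b : X → ℝ} (hb : Measurable b) (h : ∀ x, |b x| ≤ 1 / 4)
    (x : Fin M → X) :
    Measure.pi (fun m => coinKernel b (x m)) =
      (Measure.pi fun _ : Fin M => fairCoin).withDensity
        fun r => ENNReal.ofReal (∏ m, likelihood b (x m, r m)) := by
  have := isMarkovKernel_coinKernel hb h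
  refine Measure.pi_eq fun s hs => ?_
  have hmeas (m : Fin M) : Measurable fun r => ENNReal.ofReal (likelihood b (x m, r)) :=
    ((measurable_likelihood hb).comp measurable_prodMk_left).ennreal_ofReal
  rw [withDensity_apply _ (MeasurableSet.univ_pi hs),
    ← lintegral_indicator (MeasurableSet.univ_pi hs)]
  have hind (r : Fin M → ℝ) :
      (Set.univ.pi s).indicator (fun r => ENNReal.ofReal (∏ m, likelihood b (x m, r m))) r =
        ∏ m, (s m).indicator (fun r => ENNReal.ofReal (likelihood b (x m, r))) (r m) := by
    by_cases hr : r ∈ Set.univ.pi s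
    · rw [Set.indicator_of_mem hr, ENNReal.ofReal_prod_of_nonneg
        fun m _ => (likelihood_pos h _).le]
      exact Finset.prod_congr rfl fun m _ => by rw [Set.indicator_of_mem (hr m (Set.mem_univ m))]
    · rw [Set.indicator_of_notMem hr]
      simp only [Set.mem_pi, Set.mem_univ, true_imp_iff, not_forall] at hr
      obtain ⟨m, hm⟩ := hr
      exact (Finset.prod_eq_zero (Finset.mem_univ m) (Set.indicator_of_notMem hm _)).symm
  simp only [hind]
  rw [lintegral_prod_eq_prod_lintegral_of_indepFun Finset.univ
    (fun m (r : Fin M → ℝ) => (s m).indicator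
      (fun r => ENNReal.ofReal (likelihood b (x m, r))) (r m))
    (iIndepFun_pi fun m => ((hmeas m).indicator (hs m)).aemeasurable)
    (fun m => ((hmeas m).indicator (hs m)).comp (measurable_pi_apply m))]
  refine Finset.prod_congr rfl fun m _ => ?_
  rw [coinKernel_apply hb, withDensity_apply _ (hs m), ← lintegral_indicator (hs m),
    ← (measurePreserving_eval (fun _ : Fin M => fairCoin) m).lintegral_comp
      ((hmeas m).indicator (hs m))]

/-- The likelihood ratio of a history. -/
def historyLikelihood {M : ℕ} (b : X → ℝ) {t : ℕ} (h : History X M t) : ℝ :=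
  ∏ i, ∏ m, likelihood b (h i m)

theorem measurable_historyLikelihood {M : ℕ} {b : X → ℝ} (hb : Measurable b) (t : ℕ) :
    Measurable (historyLikelihood b : History X M t → ℝ) := by
  have := measurable_likelihood hb
  unfold historyLikelihood; fun_prop

theorem historyLikelihood_pos {X : Type} {M : ℕ} {b : X → ℝ} (h : ∀ x, |b x| ≤ 1 / 4) {t : ℕ}
    (w : History X M t) : 0 < historyLikelihood b w :=
  Finset.prod_pos fun _ _ => Finset.prod_pos fun _ _ => likelihood_pos h _

theorem historyLikelihood_le {X : Type} {M : ℕ} {b : X → ℝ} (h : ∀ x, |b x| ≤ 1 / 4) {t : ℕ}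
    (w : History X M t) : historyLikelihood b w ≤ ((3 / 2) ^ M) ^ t := by
  calc historyLikelihood b w ≤ ∏ _i : Fin t, ∏ _m : Fin M, (3 / 2 : ℝ) :=
        Finset.prod_le_prod (fun _ _ => Finset.prod_nonneg fun _ _ => (likelihood_pos h _).le)
          fun _ _ => Finset.prod_le_prod (fun _ _ => (likelihood_pos h _).le)
            fun _ _ => likelihood_le h _
    _ = _ := by simp only [Finset.prod_const, Finset.card_univ, Fintype.card_fin]

theorem log_historyLikelihood {X : Type} {M : ℕ} {b : X → ℝ} (h : ∀ x, |b x| ≤ 1 / 4) {t : ℕ}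
    (w : History X M t) :
    Real.log (historyLikelihood b w) = sumPulls (fun p => Real.log (likelihood b p)) w := by
  rw [historyLikelihood, Real.log_prod fun i _ =>
    (Finset.prod_pos fun _ _ => likelihood_pos h _).ne']
  exact Finset.sum_congr rfl fun i _ => Real.log_prod fun _ _ => (likelihood_pos h _).ne'

/-! ### Change of measure and relative entropy for whole histories. -/

variable {S : Type*} [MeasurableSpace S] {M : ℕ}

theorem historyLikelihood_extend (b : X → ℝ) (π : Policy S X M) (t : ℕ) (s : S)
    (w : History X M t) (r : Fin M → ℝ) :
    historyLikelihood b (π.extend t (s, (w, r))) =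
      historyLikelihood b w * ∏ m, likelihood b (π.act m t (s, w), r m) := by
  simp [historyLikelihood, Policy.extend, Fin.prod_univ_castSucc]

/-- Given the seed and the past, the policy picks the same arms on both instances, so only the
rewards contribute to the density, one factor per pull. In particular the density does not involve
the seed, which can later be integrated out. -/
theorem lintegral_historyKernel_coinInstance (π : Policy S X M) {b : X → ℝ} (hb : Measurable b)
    (h : ∀ x, |b x| ≤ 1 / 4) (t : ℕ) (s : S) {g : History X M t → ℝ≥0∞} (hg : Measurable g) :
    ∫⁻ w, g w ∂(historyKernel π (coinInstance M b hb h) t s) =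
      ∫⁻ w, ENNReal.ofReal (historyLikelihood b w) * g w
        ∂(historyKernel π (fairInstance X M) t s) := by
  induction t with
  | zero => simp [historyKernel, historyLikelihood]
  | succ t ih =>
    have hL := measurable_historyLikelihood (M := M) hb
    have he : Measurable fun q => π.extend t (s, q) :=
      (π.measurable_extend t).comp measurable_prodMk_left
    have hl := measurable_likelihood hb
    have hstep (w : History X M t) :
        ∫⁻ r, g (π.extend t (s, (w, r))) ∂(Measure.pi fun m => coinKernel b (π.act m t (s, w))) =
          ∫⁻ r, ENNReal.ofReal (∏ m, likelihood b (π.act m t (s, w), r m)) *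
            g (π.extend t (s, (w, r))) ∂(Measure.pi fun _ : Fin M => fairCoin) := by
      rw [pi_coinKernel hb h]
      exact lintegral_withDensity_eq_lintegral_mul _ (by fun_prop)
        (hg.comp (he.comp measurable_prodMk_left))
    rw [lintegral_historyKernel_succ _ _ _ _ hg, lintegral_historyKernel_succ (g := fun w =>
      ENNReal.ofReal (historyLikelihood b w) * g w) _ _ _ _ ((hL _).ennreal_ofReal.mul hg)]
    simp only [reward_coinInstance, hstep, coinKernel_zero]
    rw [ih]
    · refine lintegral_congr fun w => ?_
      rw [← lintegral_const_mul]
      · refine lintegral_congr fun r => ?_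
        rw [historyLikelihood_extend, ENNReal.ofReal_mul (historyLikelihood_pos h w).le, mul_assoc]
      · refine Measurable.mul ?_ (hg.comp (he.comp measurable_prodMk_left))
        fun_prop
    · have hact (m : Fin M) : Measurable fun w => π.act m t (s, w) :=
        (π.measurable_act m t).comp measurable_prodMk_left
      refine Measurable.lintegral_prod_right'
        (f := fun q : History X M t × (Fin M → ℝ) =>
          ENNReal.ofReal (∏ m, likelihood b (π.act m t (s, q.1), q.2 m)) *
            g (π.extend t (s, q))) ?_
      refine Measurable.mul ?_ (hg.comp he)
      refine (Finset.measurable_fun_prod _ fun m _ => hl.comp ?_).ennreal_ofReal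
      exact ((hact m).comp measurable_fst).prodMk ((measurable_pi_apply m).comp measurable_snd)

theorem historyLaw_coinInstance (P : Measure S) (π : Policy S X M) {b : X → ℝ}
    (hb : Measurable b) (h : ∀ x, |b x| ≤ 1 / 4) (T : ℕ) :
    historyLaw P π (coinInstance M b hb h) T =
      (historyLaw P π (fairInstance X M) T).withDensity
        fun w => ENNReal.ofReal (historyLikelihood b w) := by
  have hL := (measurable_historyLikelihood (M := M) hb T).ennreal_ofReal
  refine Measure.ext_of_lintegral _ fun g hg => ?_
  rw [lintegral_withDensity_eq_lintegral_mul _ hL hg]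
  simp only [historyLaw]
  rw [Measure.lintegral_bind (Kernel.aemeasurable _) hg.aemeasurable,
    Measure.lintegral_bind (Kernel.aemeasurable _) (hL.mul hg).aemeasurable]
  exact lintegral_congr fun s => lintegral_historyKernel_coinInstance π hb h T s hg

theorem integral_historyLaw_coinInstance (P : Measure S) (π : Policy S X M) {b : X → ℝ}
    (hb : Measurable b) (h : ∀ x, |b x| ≤ 1 / 4) (T : ℕ) (g : History X M T → ℝ) :
    ∫ w, g w ∂(historyLaw P π (coinInstance M b hb h) T) =
      ∫ w, historyLikelihood b w * g w ∂(historyLaw P π (fairInstance X M) T) := by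
  rw [historyLaw_coinInstance, integral_withDensity_eq_integral_toReal_smul
    (measurable_historyLikelihood hb T).ennreal_ofReal (by simp)]
  simp only [ENNReal.toReal_ofReal (historyLikelihood_pos h _).le, smul_eq_mul]

/-- A pointwise substitute for Pinsker's inequality: when `L` is a density, `L - 1 - log L`
integrates to the relative entropy and the last term to `1 / 8`. With `L = u ^ 2`, `log u ≤ u - 1`
gives `L - 1 - log L ≥ (u - 1) ^ 2`, and AM-GM bounds `|u - 1| * (u + 1)` by `8 * (u - 1) ^ 2 + (u +
1) ^ 2 / 32`. -/
theorem abs_sub_one_le {L : ℝ} (hL : 0 < L) :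
    |L - 1| ≤ 8 * (L - 1 - Real.log L) + (L + 1) / 16 := by
  obtain ⟨u, hu, rfl⟩ : ∃ u : ℝ, 0 < u ∧ L = u ^ 2 :=
    ⟨√L, Real.sqrt_pos.2 hL, (Real.sq_sqrt hL.le).symm⟩
  have h1 := Real.log_le_sub_one_of_pos hu
  rw [Real.log_pow]
  push_cast
  rw [abs_le]
  constructor <;> nlinarith [sq_nonneg (16 * (u - 1) - (u + 1)), sq_nonneg (16 * (u - 1) + (u + 1)),
    sq_nonneg (u - 1)]

theorem abs_log_likelihood_le {X : Type} {b : X → ℝ} (h : ∀ x, |b x| ≤ 1 / 4) (p : X × ℝ) :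
    |Real.log (likelihood b p)| ≤ 1 := by
  have h0 := likelihood_pos h p
  have h1 := Real.log_le_sub_one_of_pos h0
  have h2 := Real.one_sub_inv_le_log_of_pos h0
  have h3 : (likelihood b p)⁻¹ ≤ 2 := by
    rw [inv_le_comm₀ h0 (by norm_num)]
    linarith [half_le_likelihood h p]
  rw [abs_le]
  constructor <;> linarith [likelihood_le h p]

/-- The entropy cost of one pull is quadratic in the bias: the linear terms cancel in the product
`(1 - 2 * b x) * (1 + 2 * b x)`. -/
theorem neg_four_mul_sq_le_integral_log_likelihood {X : Type} {b : X → ℝ} (h : ∀ x, |b x| ≤ 1 / 4) (x : X) :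
    -(4 * b x ^ 2) ≤ ∫ r, Real.log (likelihood b (x, r)) ∂fairCoin := by
  rw [integral_fairCoin, ← Real.log_mul (likelihood_pos h _).ne' (likelihood_pos h _).ne']
  have hx := abs_le.1 (h x)
  have hsq : b x ^ 2 ≤ 1 / 16 := by nlinarith
  have he : likelihood b (x, 0) * likelihood b (x, 1) = 1 - 4 * b x ^ 2 := by
    simp only [likelihood, coinSign_zero, coinSign_one]; ring
  rw [he]
  have h2 := Real.one_sub_inv_le_log_of_pos (show 0 < 1 - 4 * b x ^ 2 by linarith)
  have h3 : (1 - 4 * b x ^ 2)⁻¹ ≤ 1 + 8 * b x ^ 2 := by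
    rw [inv_le_iff_one_le_mul₀ (by linarith)]
    nlinarith [sq_nonneg (b x)]
  linarith

/-- The number of pulls of arms in `C`. -/
abbrev pullCount (C : Set X) {t : ℕ} (w : History X M t) : ℝ :=
  sumPulls (fun p => C.indicator 1 p.1) w

theorem measurable_indicator_fst {C : Set X} (hC : MeasurableSet C) :
    Measurable fun p : X × ℝ => C.indicator (1 : X → ℝ) p.1 :=
  (measurable_one.indicator hC).comp measurable_fst

theorem abs_indicator_one_le {X : Type} (C : Set X) (x : X) : |C.indicator (1 : X → ℝ) x| ≤ 1 := by
  by_cases hx : x ∈ C <;> simp [hx]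

theorem integral_log_historyLikelihood_ge (P : Measure S) [IsProbabilityMeasure P]
    (π : Policy S X M) {b : X → ℝ} (hb : Measurable b) (h : ∀ x, |b x| ≤ 1 / 4) {C : Set X}
    (hC : MeasurableSet C) {ε : ℝ} (hε : ∀ x, |b x| ≤ C.indicator (fun _ => ε) x) (T : ℕ) :
    -(4 * ε ^ 2 * ∫ w, pullCount C w ∂(historyLaw P π (fairInstance X M) T)) ≤
      ∫ w, Real.log (historyLikelihood b w) ∂(historyLaw P π (fairInstance X M) T) := by
  have hI := measurable_indicator_fst hC
  have hl := (measurable_likelihood hb).log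
  have hbd (p : X × ℝ) :
      |Real.log (likelihood b p) + 4 * ε ^ 2 * C.indicator 1 p.1| ≤ 1 + 4 * ε ^ 2 * 1 := by
    refine (abs_add_le _ _).trans (add_le_add (abs_log_likelihood_le h p) ?_)
    rw [abs_mul, abs_of_nonneg (by positivity : (0 : ℝ) ≤ 4 * ε ^ 2)]
    exact mul_le_mul_of_nonneg_left (abs_indicator_one_le C _) (by positivity)
  -- The log-likelihood is compensated by `4 * ε ^ 2` per pull in `C`; pulls outside `C` have `b x =
  -- 0` and cost no entropy.
  have key := integral_sumPulls_nonneg P π (fairInstance X M) T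
    (φ := fun p => Real.log (likelihood b p) + 4 * ε ^ 2 * C.indicator 1 p.1)
    (hl.add (hI.const_mul _)) hbd (fun m x => by
      change 0 ≤ ∫ r, _ ∂(coinKernel 0 x)
      rw [coinKernel_zero]
      dsimp only
      rw [integral_add _ (integrable_const _)]
      · have h1 := neg_four_mul_sq_le_integral_log_likelihood h x
        have h2 : b x ^ 2 ≤ ε ^ 2 * C.indicator 1 x := by
          have h3 := hε x
          by_cases hx : x ∈ C
          · simp only [hx, Set.indicator_of_mem, Pi.one_apply, mul_one] at h3 ⊢
            exact sq_le_sq' (by linarith [neg_abs_le (b x)]) ((le_abs_self _).trans h3)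
          · simp only [hx, not_false_eq_true, Set.indicator_of_notMem] at h3 ⊢
            simp [abs_nonpos_iff.1 h3]
        simp only [integral_const, probReal_univ, one_smul]
        linarith
      · exact Integrable.of_bound (hl.comp measurable_prodMk_left).aestronglyMeasurable 1
          (.of_forall fun _ => abs_log_likelihood_le h _))
  have hsum (w : History X M T) :
      sumPulls (fun p => Real.log (likelihood b p) + 4 * ε ^ 2 * C.indicator 1 p.1) w =
        Real.log (historyLikelihood b w) + 4 * ε ^ 2 * pullCount C w := by
    simp [log_historyLikelihood h, sumPulls, Finset.sum_add_distrib, Finset.mul_sum]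
  simp only [hsum] at key
  rw [integral_add, integral_const_mul] at key
  · linarith
  · simp only [log_historyLikelihood h]
    exact integrable_sumPulls hl (abs_log_likelihood_le h) _
  · exact (integrable_sumPulls hI (fun _ => abs_indicator_one_le C _) _).const_mul _

theorem pullCount_nonneg {X : Type} (C : Set X) {t : ℕ} (w : History X M t) : 0 ≤ pullCount C w :=
  Finset.sum_nonneg fun _ _ => Finset.sum_nonneg fun _ _ =>
    Set.indicator_nonneg (fun _ _ => zero_le_one) _

theorem pullCount_le {X : Type} (C : Set X) {t : ℕ} (w : History X M t) : pullCount C w ≤ t * M := by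
  simpa using (le_abs_self _).trans
    (abs_sumPulls_le (B := 1) (fun p : X × ℝ => abs_indicator_one_le C p.1) w)

theorem integral_pullCount_coinInstance_le (P : Measure S) [IsProbabilityMeasure P]
    (π : Policy S X M) {b : X → ℝ} (hb : Measurable b) (h : ∀ x, |b x| ≤ 1 / 4) {C : Set X}
    (hC : MeasurableSet C) {ε : ℝ} (hε : ∀ x, |b x| ≤ C.indicator (fun _ => ε) x) (T : ℕ) :
    ∫ w, pullCount C w ∂(historyLaw P π (coinInstance M b hb h) T) ≤
      ∫ w, pullCount C w ∂(historyLaw P π (fairInstance X M) T) +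
        T * M * (32 * ε ^ 2 * ∫ w, pullCount C w ∂(historyLaw P π (fairInstance X M) T) + 1 / 8) := by
  have hlog := integral_log_historyLikelihood_ge P π hb h hC hε T
  -- The test function `1` shows that the likelihood has integral `1`.
  have hmass := integral_historyLaw_coinInstance P π hb h T 1
  rw [integral_historyLaw_coinInstance]
  set μ := historyLaw P π (fairInstance X M) T
  have hN : Integrable (fun w : History X M T => pullCount C w) μ :=
    integrable_sumPulls (measurable_indicator_fst hC) (fun _ => abs_indicator_one_le C _) _
  have hL : Integrable (fun w : History X M T => historyLikelihood b w) μ :=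
    Integrable.of_bound (measurable_historyLikelihood hb T).aestronglyMeasurable _
      (.of_forall fun w => by
        rw [Real.norm_of_nonneg (historyLikelihood_pos h w).le]
        exact historyLikelihood_le h w)
  have hlogi : Integrable (fun w : History X M T => Real.log (historyLikelihood b w)) μ := by
    simp only [log_historyLikelihood h]
    exact integrable_sumPulls (measurable_likelihood hb).log (abs_log_likelihood_le h) _
  simp only [Pi.one_apply, integral_const, probReal_univ, smul_eq_mul, mul_one] at hmass
  -- As the pull count lies in `[0, T * M]`, reweighting it costs at most `T * M * |L - 1|`. After
  -- integration, `8` times the entropy bound yields `32 * ε ^ 2`, and `(1 + 1) / 16` yields `1 /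
  -- 8`.
  have hpt (w : History X M T) : historyLikelihood b w * pullCount C w ≤ pullCount C w +
      T * M * (8 * (historyLikelihood b w - 1 - Real.log (historyLikelihood b w)) +
        (historyLikelihood b w + 1) / 16) := by
    have h1 := abs_sub_one_le (historyLikelihood_pos h w)
    have h2 : (historyLikelihood b w - 1) * pullCount C w ≤
        |historyLikelihood b w - 1| * (T * M) :=
      mul_le_mul (le_abs_self _) (pullCount_le C w) (pullCount_nonneg C w) (abs_nonneg _)
    have h3 := mul_le_mul_of_nonneg_left h1 (by positivity : (0 : ℝ) ≤ T * M)
    linarith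
  have hLs : Integrable (fun w : History X M T => historyLikelihood b w - 1) μ :=
    hL.sub (integrable_const _)
  have hA : Integrable (fun w : History X M T =>
      8 * (historyLikelihood b w - 1 - Real.log (historyLikelihood b w))) μ :=
    (hLs.sub hlogi).const_mul _
  have hB : Integrable (fun w : History X M T => (historyLikelihood b w + 1) / 16) μ :=
    (hL.add (integrable_const _)).div_const _
  have hLN : Integrable (fun w : History X M T => historyLikelihood b w * pullCount C w) μ :=
    hN.bdd_mul (measurable_historyLikelihood hb T).aestronglyMeasurable
      (.of_forall fun w => by
        rw [Real.norm_of_nonneg (historyLikelihood_pos h w).le]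
        exact historyLikelihood_le h w)
  have hAB : Integrable (fun w : History X M T => T * M *
      (8 * (historyLikelihood b w - 1 - Real.log (historyLikelihood b w)) +
        (historyLikelihood b w + 1) / 16)) μ := (hA.add hB).const_mul _
  refine (integral_mono hLN (hN.add hAB) hpt).trans ?_
  simp only [Pi.add_apply]
  rw [integral_add hN hAB, integral_const_mul, integral_add hA hB,
    integral_const_mul, integral_sub hLs hlogi,
    integral_sub hL (integrable_const _), integral_div, integral_add hL (integrable_const _),
    ← hmass]
  simp only [integral_const, probReal_univ, smul_eq_mul, mul_one]
  refine add_le_add_right (mul_le_mul_of_nonneg_left ?_ (by positivity)) _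
  linarith

theorem integrable_pullCount {C : Set X} (hC : MeasurableSet C) {T : ℕ}
    (μ : Measure (History X M T)) [IsFiniteMeasure μ] : Integrable (fun w => pullCount C w) μ :=
  integrable_sumPulls (measurable_indicator_fst hC) (fun _ => abs_indicator_one_le C _) μ

/-- Pigeonhole: each pull lands in at most one of the disjoint sets, so the expected counts add up
to at most `T * M`. -/
theorem exists_integral_pullCount_le {ι : Type*} [Fintype ι] [Nonempty ι] {C : ι → Set X}
    (hC : ∀ i, MeasurableSet (C i)) (hd : Pairwise (Function.onFun Disjoint C)) {T : ℕ}
    (μ : Measure (History X M T)) [IsProbabilityMeasure μ] :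
    ∃ i, ∫ w, pullCount (C i) w ∂μ ≤ T * M / Fintype.card ι := by
  have hpt (x : X) : ∑ i, (C i).indicator (1 : X → ℝ) x ≤ 1 := by
    by_cases hx : ∃ i, x ∈ C i
    · obtain ⟨i, hi⟩ := hx
      rw [Finset.sum_eq_single i (fun j _ hj => Set.indicator_of_notMem
        (fun hxj => Set.disjoint_left.1 (hd hj) hxj hi) _) (by simp), Set.indicator_of_mem hi]
      rfl
    · push Not at hx
      rw [Finset.sum_eq_zero fun i _ => Set.indicator_of_notMem (hx i) _]
      exact zero_le_one
  have hsum (w : History X M T) : ∑ i, pullCount (C i) w ≤ T * M := by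
    simp only [pullCount, sumPulls]
    rw [Finset.sum_comm]
    calc _ = ∑ t, ∑ m, ∑ i, (C i).indicator (1 : X → ℝ) (w t m).1 :=
          Finset.sum_congr rfl fun _ _ => Finset.sum_comm
      _ ≤ ∑ _t : Fin T, ∑ _m : Fin M, (1 : ℝ) :=
          Finset.sum_le_sum fun _ _ => Finset.sum_le_sum fun _ _ => hpt _
      _ = T * M := by simp
  have hint : ∑ i, ∫ w, pullCount (C i) w ∂μ ≤ T * M := by
    rw [← integral_finsetSum _ fun i _ => integrable_pullCount (hC i) μ]
    refine (integral_mono (integrable_finsetSum _ fun i _ => integrable_pullCount (hC i) μ)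
      (integrable_const _) hsum).trans ?_
    simp
  obtain ⟨i, -, hi⟩ := Finset.exists_le_of_sum_le (s := Finset.univ) Finset.univ_nonempty
    (f := fun i => ∫ w, pullCount (C i) w ∂μ) (g := fun _ => T * M / (Fintype.card ι : ℝ)) (by
      have : (Fintype.card ι : ℝ) ≠ 0 := by simp
      simpa [mul_div_cancel₀ _ this] using hint)
  exact ⟨i, hi⟩

end CoinFlips

/-! ### Instances with one hidden cone, and their regret. -/

section Bump

variable {X : Type} [PseudoMetricSpace X]

/-- The cone of height and radius `ε` around `c`. -/
def bump (ε : ℝ) (c x : X) : ℝ := max 0 (ε - dist x c)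

theorem bump_nonneg (ε : ℝ) (c x : X) : 0 ≤ bump ε c x := le_max_left _ _

theorem bump_le {ε : ℝ} (hε : 0 ≤ ε) (c x : X) : bump ε c x ≤ ε :=
  max_le hε (by linarith [dist_nonneg (x := x) (y := c)])

theorem bump_self {ε : ℝ} (hε : 0 ≤ ε) (c : X) : bump ε c c = ε := by simp [bump, hε]

/-- Used twice: outside the ball the rewards carry no information on `c`, and every pull there costs
the full `ε`. -/
theorem bump_le_indicator {ε : ℝ} (hε : 0 ≤ ε) (c x : X) :
    bump ε c x ≤ (Metric.ball c ε).indicator (fun _ => ε) x := by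
  by_cases hx : x ∈ Metric.ball c ε
  · rw [Set.indicator_of_mem hx]; exact bump_le hε c x
  · rw [Set.indicator_of_notMem hx]
    rw [Metric.mem_ball, not_lt] at hx
    exact max_le le_rfl (by linarith)

theorem lipschitzWith_bump (ε : ℝ) (c : X) : LipschitzWith 1 (bump ε c) := by
  refine LipschitzWith.of_dist_le_mul fun x y => ?_
  rw [NNReal.coe_one, one_mul, Real.dist_eq]
  refine (by simpa [bump] using abs_max_sub_max_le_max 0 (ε - dist x c) 0 (ε - dist y c) :
    |bump ε c x - bump ε c y| ≤ |ε - dist x c - (ε - dist y c)|).trans ?_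
  rw [sub_sub_sub_cancel_left, abs_sub_comm]
  exact abs_dist_sub_le x y c

theorem abs_bump_le_quarter {ε : ℝ} (hε : 0 ≤ ε) (hε' : ε ≤ 1 / 4) (c x : X) :
    |bump ε c x| ≤ 1 / 4 := by
  rw [abs_of_nonneg (bump_nonneg ε c x)]
  exact (bump_le hε c x).trans hε'

variable [MeasurableSpace X] [OpensMeasurableSpace X]

theorem measurable_bump (ε : ℝ) (c : X) : Measurable (bump ε c) :=
  (lipschitzWith_bump ε c).continuous.measurable

/-- Bernoulli rewards with mean `1 / 2`, raised by a bump around the arm `c`. -/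
def bumpInstance (M : ℕ) {ε : ℝ} (hε : 0 ≤ ε) (hε' : ε ≤ 1 / 4) (c : X) : Instance X M :=
  coinInstance M (bump ε c) (measurable_bump ε c) (abs_bump_le_quarter hε hε' c)

variable {M : ℕ}

theorem globalObjective_bumpInstance (hM : 1 ≤ M) {ε : ℝ} (hε : 0 ≤ ε) (hε' : ε ≤ 1 / 4)
    (c x : X) : (bumpInstance M hε hε' c).globalObjective x = 1 / 2 + bump ε c x :=
  globalObjective_coinInstance hM _ _ x

theorem localObjective_bumpInstance (hM : 1 ≤ M) {ε : ℝ} (hε : 0 ≤ ε) (hε' : ε ≤ 1 / 4)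
    (c : X) (m : Fin M) : (bumpInstance M hε hε' c).localObjective m =
      (bumpInstance M hε hε' c).globalObjective := by
  funext x
  rw [globalObjective_bumpInstance hM]
  exact localObjective_coinInstance M _ _ m x

theorem lipschitzWith_globalObjective_bumpInstance (hM : 1 ≤ M) {ε : ℝ} (hε : 0 ≤ ε)
    (hε' : ε ≤ 1 / 4) (c : X) : LipschitzWith 1 (bumpInstance M hε hε' c).globalObjective := by
  refine LipschitzWith.of_dist_le_mul fun x y => ?_
  rw [globalObjective_bumpInstance hM, globalObjective_bumpInstance hM, dist_add_left]
  exact (lipschitzWith_bump ε c).dist_le_mul x y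

theorem iSup_globalObjective_bumpInstance (hM : 1 ≤ M) {ε : ℝ} (hε : 0 ≤ ε) (hε' : ε ≤ 1 / 4)
    (c : X) : ⨆ x, (bumpInstance M hε hε' c).globalObjective x = 1 / 2 + ε := by
  have hle (x : X) : (bumpInstance M hε hε' c).globalObjective x ≤ 1 / 2 + ε := by
    rw [globalObjective_bumpInstance hM]
    linarith [bump_le hε c x]
  have : Nonempty X := ⟨c⟩
  refine le_antisymm (ciSup_le hle) ?_
  refine le_ciSup_of_le ⟨_, Set.forall_mem_range.2 hle⟩ c ?_
  rw [globalObjective_bumpInstance hM, bump_self hε]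

theorem regret_bumpInstance (hM : 1 ≤ M) {ε : ℝ} (hε : 0 ≤ ε) (hε' : ε ≤ 1 / 4) (c : X) {T : ℕ}
    (w : History X M T) :
    (bumpInstance M hε hε' c).regret w = sumPulls (fun p => ε - bump ε c p.1) w := by
  simp only [Instance.regret, iSup_globalObjective_bumpInstance hM]
  simp only [globalObjective_bumpInstance hM, add_sub_add_left_eq_sub, sumPulls]

theorem le_regret_bumpInstance (hM : 1 ≤ M) {ε : ℝ} (hε : 0 ≤ ε) (hε' : ε ≤ 1 / 4) (c : X)
    {T : ℕ} (w : History X M T) :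
    ε * (T * M - pullCount (Metric.ball c ε) w) ≤ (bumpInstance M hε hε' c).regret w := by
  have hsum : ε * (T * M - pullCount (Metric.ball c ε) w) =
      ∑ i, ∑ m, (ε - (Metric.ball c ε).indicator (fun _ => ε) (w i m).1) := by
    have hind (x : X) : (Metric.ball c ε).indicator (fun _ => ε) x =
        ε * (Metric.ball c ε).indicator 1 x := by
      by_cases hx : x ∈ Metric.ball c ε <;> simp only [hx, Set.indicator_of_mem,
        Set.indicator_of_notMem, not_false_eq_true, Pi.one_apply, mul_one, mul_zero]
    simp only [hind, Finset.sum_sub_distrib, ← Finset.mul_sum, pullCount, sumPulls]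
    simp only [Finset.sum_const, Finset.card_univ, Fintype.card_fin, nsmul_eq_mul]
    ring
  rw [hsum, regret_bumpInstance hM]
  exact Finset.sum_le_sum fun i _ => Finset.sum_le_sum fun m _ =>
    sub_le_sub_left (bump_le_indicator hε c _) _

variable {S : Type*} [MeasurableSpace S]

theorem le_expectedRegret_bumpInstance (P : Measure S) [IsProbabilityMeasure P]
    (π : Policy S X M) (hM : 1 ≤ M) {ε : ℝ} (hε : 0 ≤ ε) (hε' : ε ≤ 1 / 4) (c : X) (T : ℕ) :
    ε * (T * M - ∫ w, pullCount (Metric.ball c ε) w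
      ∂(historyLaw P π (bumpInstance M hε hε' c) T)) ≤
        expectedRegret P π (bumpInstance M hε hε' c) T := by
  set μ := historyLaw P π (bumpInstance M hε hε' c) T with hμ
  have hN := integrable_pullCount (M := M) (Metric.isOpen_ball (x := c) (ε := ε)).measurableSet μ
  have hlin : ∫ w, ε * (T * M - pullCount (Metric.ball c ε) w) ∂μ =
      ε * (T * M - ∫ w, pullCount (Metric.ball c ε) w ∂μ) := by
    rw [integral_const_mul, integral_sub (integrable_const _) hN]
    simp
  rw [← hlin, expectedRegret, ← hμ]
  refine integral_mono (((integrable_const _).sub hN).const_mul _) ?_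
    (le_regret_bumpInstance hM hε hε' c)
  rw [show (bumpInstance M hε hε' c).regret = _ from
    funext (regret_bumpInstance hM hε hε' c (T := T))]
  have hm := measurable_bump ε c
  refine integrable_sumPulls (B := ε) (by fun_prop) (fun p => ?_) μ
  rw [abs_le]
  constructor <;> linarith [bump_nonneg ε c p.1, bump_le hε c p.1]

theorem exists_bumpInstance_le_expectedRegret (P : Measure S) [IsProbabilityMeasure P]
    (π : Policy S X M) (hM : 1 ≤ M) (T : ℕ) {ι : Type*} [Fintype ι]
    (hι : 2 ≤ Fintype.card ι) {ε : ℝ} (hε : 0 ≤ ε) (hε' : ε ≤ 1 / 4) (c : ι → X)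
    (hd : Pairwise (Function.onFun Disjoint fun i => Metric.ball (c i) ε))
    (hT : 256 * ε ^ 2 * (T * M) ≤ Fintype.card ι) :
    ∃ i, ε * (T * M / 4) ≤ expectedRegret P π (bumpInstance M hε hε' (c i)) T := by
  have : Nonempty ι := Fintype.card_pos_iff.1 (by omega)
  have hι' : (2 : ℝ) ≤ Fintype.card ι := by exact_mod_cast hι
  obtain ⟨i, hi⟩ := exists_integral_pullCount_le (M := M)
    (fun i => (Metric.isOpen_ball (x := c i) (ε := ε)).measurableSet) hd
    (historyLaw P π (fairInstance X M) T)
  refine ⟨i, le_trans ?_ (le_expectedRegret_bumpInstance P π hM hε hε' (c i) T)⟩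
  have key := integral_pullCount_coinInstance_le P π (measurable_bump ε (c i))
    (abs_bump_le_quarter hε hε' (c i)) (Metric.isOpen_ball (x := c i) (ε := ε)).measurableSet
    (ε := ε) (fun x => by
      rw [abs_of_nonneg (bump_nonneg _ _ _)]; exact bump_le_indicator hε (c i) x) T
  change ∫ w, _ ∂(historyLaw P π (bumpInstance M hε hε' (c i)) T) ≤ _ at key
  set q := ∫ w, pullCount (Metric.ball (c i) ε) w ∂(historyLaw P π (fairInstance X M) T)
  have hN : (0 : ℝ) ≤ T * M := by positivity
  -- Together, `1 / 2` from this bound, `1 / 8` from the entropy and `1 / 8` from `abs_sub_one_le`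
  -- put at most `3 / 4` of all pulls in the ball.
  have hq : q ≤ T * M / 2 := hi.trans (div_le_div_of_nonneg_left hN (by norm_num) hι')
  have hsmall : 32 * ε ^ 2 * q ≤ 1 / 8 := by
    calc 32 * ε ^ 2 * q ≤ 32 * ε ^ 2 * (T * M / Fintype.card ι) := by gcongr
      _ = 256 * ε ^ 2 * (T * M) / Fintype.card ι / 8 := by ring
      _ ≤ 1 / 8 := by
        gcongr
        exact (div_le_one (by linarith)).2 hT
  have hprod := mul_le_mul_of_nonneg_left (add_le_add_left hsmall (1 / 8)) hN
  refine mul_le_mul_of_nonneg_left ?_ hε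
  linarith

end Bump

/-! ### Disjoint balls in the cube and the choice of resolution. -/

section Grid

variable {d K : ℕ}

/-- The centres of the `K ^ d` cells of the regular grid in `[0,1]^d`. -/
def gridCenter (i : Fin d → Fin K) : Cube d := fun j =>
  ⟨(2 * (i j : ℝ) + 1) / (2 * K), by
    have h : ((i j : ℕ) : ℝ) + 1 ≤ K := by exact_mod_cast (i j).isLt
    have hK : (0 : ℝ) < K := by positivity [(i j).pos]
    rw [Set.mem_Icc]
    refine ⟨by positivity, (div_le_one (by positivity)).2 (by linarith)⟩⟩

theorem inv_le_dist_gridCenter {i j : Fin d → Fin K} (h : i ≠ j) :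
    (1 : ℝ) / K ≤ dist (gridCenter i) (gridCenter j) := by
  obtain ⟨a, ha⟩ := Function.ne_iff.1 h
  refine le_trans ?_ (dist_le_pi_dist _ _ a)
  have hK : (0 : ℝ) < K := by exact_mod_cast (i a).pos
  rw [Subtype.dist_eq, Real.dist_eq]
  simp only [gridCenter]
  -- The coordinates differ by a nonzero integer multiple of `1 / K`; the cast through `ℤ` makes
  -- that integer at least `1` in absolute value.
  have he : (2 * ((i a : ℕ) : ℝ) + 1) / (2 * K) - (2 * ((j a : ℕ) : ℝ) + 1) / (2 * K) =
      (((i a : ℕ) : ℤ) - ((j a : ℕ) : ℤ) : ℤ) / K := by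
    push_cast
    field_simp
    ring
  rw [he, abs_div, abs_of_pos hK]
  gcongr
  have hne : ((i a : ℕ) : ℤ) - ((j a : ℕ) : ℤ) ≠ 0 := by
    have := Fin.val_ne_of_ne ha
    omega
  exact_mod_cast Int.one_le_abs hne

theorem pairwise_disjoint_ball_gridCenter (hK : 0 < K) :
    Pairwise (Function.onFun Disjoint
      fun i : Fin d → Fin K => Metric.ball (gridCenter i) (1 / (4 * K))) := by
  intro i j hij
  refine Metric.ball_disjoint_ball (le_trans ?_ (inv_le_dist_gridCenter hij))
  have : (0 : ℝ) < K := by exact_mod_cast hK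
  rw [← sub_nonneg]
  have : (1 : ℝ) / K - (1 / (4 * K) + 1 / (4 * K)) = 1 / (2 * K) := by field_simp; norm_num
  rw [this]
  positivity

end Grid

/-- A grid resolution that is fine enough for the lower bound, but not finer than necessary. -/
theorem exists_resolution {N : ℝ} (hN : 1 ≤ N) (d : ℕ) :
    ∃ K : ℕ, 2 ≤ K ∧ 16 * N ≤ (K : ℝ) ^ (d + 2) ∧ (K : ℝ) ≤ 32 * N ^ (1 / ((d : ℝ) + 2)) := by
  have hd : (0 : ℝ) < (d : ℝ) + 2 := by positivity
  set y : ℝ := (16 * N) ^ (1 / ((d : ℝ) + 2)) with hy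
  have hy1 : 1 < y := Real.one_lt_rpow (by linarith) (by positivity)
  have hpow : y ^ (d + 2) = 16 * N := by
    rw [hy, ← Real.rpow_natCast, ← Real.rpow_mul (by linarith)]
    push_cast
    rw [one_div_mul_cancel hd.ne', Real.rpow_one]
  -- Since `y > 1`, rounding up gives at least `2` and at most doubles `y`, which turns the constant
  -- `16` into `32`.
  refine ⟨⌈y⌉₊, ?_, ?_, ?_⟩
  · exact Nat.lt_ceil.2 (by exact_mod_cast hy1)
  · rw [← hpow]
    exact pow_le_pow_left₀ (by linarith) (Nat.le_ceil y) _
  · have h16 : (16 : ℝ) ^ (1 / ((d : ℝ) + 2)) ≤ 16 := by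
      conv_rhs => rw [← Real.rpow_one 16]
      exact Real.rpow_le_rpow_of_exponent_le (by norm_num)
        ((div_le_one hd).2 (by linarith [(Nat.cast_nonneg d : (0 : ℝ) ≤ d)]))
    have hsplit : y ≤ 16 * N ^ (1 / ((d : ℝ) + 2)) := by
      rw [hy, Real.mul_rpow (by norm_num) (by linarith)]
      exact mul_le_mul_of_nonneg_right h16 (Real.rpow_nonneg (by linarith) _)
    have := Nat.ceil_lt_add_one (by linarith : 0 ≤ y)
    linarith

end

end FedBandit

/-! ### The lower bound, with the parameters inserted. -/

theorem mainTheorem3 :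
    ∃ c : ℝ, 0 < c ∧
      ∀ (d M T : ℕ), 1 ≤ d → 1 ≤ M → 1 ≤ T →
      ∀ (S : Type*) [MeasurableSpace S] (P : MeasureTheory.Measure S)
        [MeasureTheory.IsProbabilityMeasure P]
        (π : FedBandit.Policy S (FedBandit.Cube d) M),
      ∃ I : FedBandit.Instance (FedBandit.Cube d) M,
        (∀ m, I.localObjective m = I.globalObjective) ∧
        LipschitzWith 1 I.globalObjective ∧
        c * (M : ℝ) ^ (((d : ℝ) + 1) / ((d : ℝ) + 2)) * (T : ℝ) ^ (((d : ℝ) + 1) / ((d : ℝ) + 2))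
          ≤ FedBandit.expectedRegret P π I T := by
  -- The regret bound `ε * T * M / 4` equals `T * M / (16 * K)`, and `K ≤ 32 * (T * M) ^ (1 / (d +
  -- 2))`; hence `512 = 16 * 32`.
  refine ⟨1 / 512, by norm_num, fun d M T hd hM hT S _ P _ π => ?_⟩
  have hM' : (1 : ℝ) ≤ M := by exact_mod_cast hM
  have hT' : (1 : ℝ) ≤ T := by exact_mod_cast hT
  have hN : (1 : ℝ) ≤ T * M := one_le_mul_of_one_le_of_one_le hT' hM'
  obtain ⟨K, hK, hKlow, hKup⟩ := FedBandit.exists_resolution hN d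
  have hKr : (2 : ℝ) ≤ K := by exact_mod_cast hK
  have hK0 : (0 : ℝ) < K := by linarith
  have hε : (0 : ℝ) ≤ 1 / (4 * K) := by positivity
  have hε' : (1 : ℝ) / (4 * K) ≤ 1 / 4 :=
    div_le_div_of_nonneg_left (by norm_num) (by norm_num) (by linarith)
  have hcard : Fintype.card (Fin d → Fin K) = K ^ d := by simp
  obtain ⟨i, hi⟩ := FedBandit.exists_bumpInstance_le_expectedRegret P π hM T
    (ι := Fin d → Fin K) (by
      rw [hcard]
      exact hK.trans (Nat.le_self_pow (by omega) K))
    hε hε' FedBandit.gridCenter (FedBandit.pairwise_disjoint_ball_gridCenter (by omega)) (by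
      rw [hcard]
      push_cast
      -- With `ε = 1 / (4 * K)` the entropy condition becomes `16 * T * M ≤ K ^ (d + 2)`, the lower
      -- bound on `K` supplied by `exists_resolution`.
      have h : 256 * (1 / (4 * (K : ℝ))) ^ 2 * (T * M) = 16 * (T * M) / K ^ 2 := by
        field_simp; norm_num
      rw [h, div_le_iff₀ (by positivity), ← pow_add]
      exact hKlow)
  refine ⟨_, FedBandit.localObjective_bumpInstance hM hε hε' _,
    FedBandit.lipschitzWith_globalObjective_bumpInstance hM hε hε' _, le_trans ?_ hi⟩
  have hd2 : (0 : ℝ) < (d : ℝ) + 2 := by positivity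
  have hexp : ((d : ℝ) + 1) / ((d : ℝ) + 2) + 1 / ((d : ℝ) + 2) = 1 := by field_simp; ring
  have hsplit : ((T : ℝ) * M) ^ (((d : ℝ) + 1) / ((d : ℝ) + 2)) *
      ((T : ℝ) * M) ^ (1 / ((d : ℝ) + 2)) = T * M := by
    rw [← Real.rpow_add (by linarith), hexp, Real.rpow_one]
  rw [mul_assoc, mul_comm ((M : ℝ) ^ _), ← Real.mul_rpow (by linarith) (by linarith)]
  set A := ((T : ℝ) * M) ^ (((d : ℝ) + 1) / ((d : ℝ) + 2)) with hA
  have hA0 : 0 ≤ A := Real.rpow_nonneg (by linarith) _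
  have hAK := mul_le_mul_of_nonneg_left hKup hA0
  have hgoal : 1 / (4 * (K : ℝ)) * (T * M / 4) = T * M / (16 * K) := by field_simp; norm_num
  rw [hgoal, le_div_iff₀ (by positivity)]
  linarith
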